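/- Let $K$ be a field of characteristic $0$ and $K[X]=K[x_1,\dots,x_n]$. For $f\in K[X]\setminus K$ let $\mathrm{cls}(f)$ be the largest $k$ such that $x_k$ occurs in $f$; the variable $x_k$ is the leading variable $\mathrm{lv}(f)$. Let $\mathrm{ini}(f)$ be the leading coefficient of $f$ as a polynomial in $\mathrm{lv}(f)$, and let $C_f\subset K[X]$ be the set of all nonzero coefficients of $f$ as a polynomial in $\mathrm{lv}(f)$. Let $T=[f_1,\dots,f_s]$, $s\ge 1$, be a triangular set in $K[X]$, i.e. $f_i\in K[X]\setminus K$ and $\mathrm{cls}(f_1)<\dots<\mathrm{cls}(f_s)$; put $y_i=\mathrm{lv}(f_i)$. For $p\in K[X]$ let $\mathrm{res}(p,T)=\mathrm{res}(\dots\mathrm{res}(\mathrm{res}(p,f_s,y_s),f_{s-1},y_{s-1})\dots,f_1,y_1)$ be the iterated Sylvester resultant, and for $f\in T$ put $R_f=\{\mathrm{res}(c,T) : c\in C_f,\ \mathrm{res}(c,T)\neq 0\}$. Define the U-set of $T$ by $$\mathbb U_T=\{\mathrm{ini}(f) : f\in T,\ \mathrm{res}(\mathrm{ini}(f),T)\ne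 0,\ R_f\cap K=\emptyset\}\ \cup\ \{\mathrm{ini}(f) : f\in T,\ \mathrm{res}(\mathrm{ini}(f),T)=0\}$$ and put $U=\prod_{u\in\mathbb U_T}u$ (with $U=1$ if $\mathbb U_T=\emptyset$). For an ideal $I$ and $h\in K[X]$ write $I:h^\infty=\{g\in K[X] : h^qg\in I\text{ for some }q>0\}$, let $\mathrm{Ideal}(T)$ be the ideal generated by $f_1,\dots,f_s$, and let $\mathrm{sat}(T)=\mathrm{Ideal}(T):J^\infty$ with $J=\prod_{i=1}^s\mathrm{ini}(f_i)$. For an extension field $L$ of $K$ let $\mathrm{Zero}_L(I)\subseteq L^n$ be the set of common zeros of $I$. **Theorem 4.1.** For every triangular set $T$ in $K[X]$ and every extension field $L$ of $K$ (in particular for $L$ an algebraic closure of $K$), $$\mathrm{Zero}_L(\mathrm{sat}(T))=\mathrm{Zero}_L(\mathrm{Ideal}(T):U^\infty).$$ The same equality holds when $\mathbb U_T$ is replaced by the larger set $$\mathbb U'_T=\{c\in C_f : f\in T,\ \mathrm{res}(\mathrm{ini}(f),T)\ne 0,\ R_f\cap K=\emptyset,\ \mathrm{res}(c,T)\neq0\}\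 \cup\ \{\mathrm{ini}(f) : f\in T,\ \mathrm{res}(\mathrm{ini}(f),T)=0\}$$ and $U$ by the product of the elements of $\mathbb U'_T$. -/

import Mathlib

noncomputable section

namespace TriSet

open MvPolynomial

variable {K : Type*} [Field K] {n : ℕ}

/-- `p` viewed as a univariate polynomial in the variable `X k`; its coefficients are the
polynomials in the other variables, again regarded as elements of `K[X]`. -/
def asUni (k : Fin n) (p : MvPolynomial (Fin n) K) : Polynomial (MvPolynomial (Fin n) K) :=
  aeval (fun i => if i = k then (Polynomial.X : Polynomial (MvPolynomial (Fin n) K))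
    else Polynomial.C (X i)) p

/-- The class of `p`: the biggest index of a variable that occurs in `p` (`⊥` for a constant). -/
def cls (p : MvPolynomial (Fin n) K) : WithBot (Fin n) := p.vars.max

/-- `p` as a univariate polynomial in its leading variable (a constant is left as it is). -/
def inLead (p : MvPolynomial (Fin n) K) : Polynomial (MvPolynomial (Fin n) K) :=
  if h : p.vars.Nonempty then asUni (p.vars.max' h) p else Polynomial.C p

/-- The initial of `p`: its leading coefficient with respect to its leading variable. -/
def ini (p : MvPolynomial (Fin n) K) : MvPolynomial (Fin n) K := (inLead p).leadingCoeff

/-- The set of nonzero coefficients of `f` with respect to its leading variable. -/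
def coeffSet (f : MvPolynomial (Fin n) K) : Finset (MvPolynomial (Fin n) K) := (inLead f).coeffs

/-- The Sylvester resultant of `p` and `f` with respect to the leading variable of `f`
(only used for a nonconstant `f`). -/
def resLead (p f : MvPolynomial (Fin n) K) : MvPolynomial (Fin n) K :=
  if h : f.vars.Nonempty then
    Polynomial.resultant (asUni (f.vars.max' h) p) (asUni (f.vars.max' h) f)
  else p

/-- The iterated resultant `res(… res(res(p, fₛ, yₛ), fₛ₋₁, yₛ₋₁) …, f₁, y₁)` of `p` with respect
to `T = [f₁, …, fₛ]`, where `yᵢ` is the leading variable of `fᵢ`. -/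
def res (p : MvPolynomial (Fin n) K) (T : List (MvPolynomial (Fin n) K)) :
    MvPolynomial (Fin n) K :=
  T.foldr (fun f q => resLead q f) p

/-- A triangular set: a finite nonempty list of nonconstant polynomials of strictly increasing
class. -/
structure IsTriangularSet (T : List (MvPolynomial (Fin n) K)) : Prop where
  nonempty : T ≠ []
  nonconst : ∀ f ∈ T, f ∉ Set.range (C : K → MvPolynomial (Fin n) K)
  increasing : T.Pairwise fun f g => cls f < cls g

/-- The ideal generated by the members of `T`. -/
def idealOf (T : List (MvPolynomial (Fin n) K)) : Ideal (MvPolynomial (Fin n) K) :=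
  Ideal.span {f | f ∈ T}

/-- The saturation `I : h^∞ = {g | h ^ q * g ∈ I for some q > 0}`. -/
def saturate (I : Ideal (MvPolynomial (Fin n) K)) (h : MvPolynomial (Fin n) K) :
    Ideal (MvPolynomial (Fin n) K) where
  carrier := {g | ∃ q : ℕ, 0 < q ∧ h ^ q * g ∈ I}
  zero_mem' := ⟨1, one_pos, by simp⟩
  add_mem' := by
    rintro a b ⟨q, hq, ha⟩ ⟨r, _, hb⟩
    refine ⟨q + r, by omega, ?_⟩
    have e : h ^ (q + r) * (a + b) = h ^ r * (h ^ q * a) + h ^ q * (h ^ r * b) := by ring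
    rw [e]
    exact I.add_mem (I.mul_mem_left _ ha) (I.mul_mem_left _ hb)
  smul_mem' := by
    rintro c a ⟨q, hq, ha⟩
    refine ⟨q, hq, ?_⟩
    have e : h ^ q * (c • a) = c * (h ^ q * a) := by rw [smul_eq_mul]; ring
    rw [e]
    exact I.mul_mem_left _ ha

/-- The saturation ideal of `T`: saturation by the product of all the initials. -/
def sat (T : List (MvPolynomial (Fin n) K)) : Ideal (MvPolynomial (Fin n) K) :=
  saturate (idealOf T) (T.map ini).prod

/-- The set `R_f` of nonzero resultants `res(c, T)`, for `c` a nonzero coefficient of `f` in its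
leading variable. -/
def resSet (T : List (MvPolynomial (Fin n) K)) (f : MvPolynomial (Fin n) K) :
    Set (MvPolynomial (Fin n) K) :=
  {r | r ≠ 0 ∧ ∃ c ∈ coeffSet f, r = res c T}

open Classical in
/-- The members `f` of `T` with `res(ini f, T) ≠ 0` and `R_f ∩ K = ∅`. -/
def critical (T : List (MvPolynomial (Fin n) K)) : Finset (MvPolynomial (Fin n) K) :=
  T.toFinset.filter fun f =>
    res (ini f) T ≠ 0 ∧ resSet T f ∩ Set.range (C : K → MvPolynomial (Fin n) K) = ∅

open Classical in
/-- The initials of members of `T` whose resultant with respect to `T` is zero. -/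
def singularInitials (T : List (MvPolynomial (Fin n) K)) : Finset (MvPolynomial (Fin n) K) :=
  (T.toFinset.image ini).filter fun c => res c T = 0

open Classical in
/-- The U-set of `T`: the initials of the critical members, and the initials with zero
resultant. -/
def uSet (T : List (MvPolynomial (Fin n) K)) : Finset (MvPolynomial (Fin n) K) :=
  (critical T).image ini ∪ singularInitials T

open Classical in
/-- The larger variant of the U-set, in which a critical `f` contributes not only its initial but
every coefficient `c` in its leading variable with `res(c, T) ≠ 0`. -/
def uSetFull (T : List (MvPolynomial (Fin n) K)) : Finset (MvPolynomial (Fin n) K) :=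
  (critical T).biUnion (fun f => (coeffSet f).filter fun c => res c T ≠ 0) ∪ singularInitials T

end TriSet

end

noncomputable section

namespace TriSet

open MvPolynomial

variable {K : Type*} [Field K] {n : ℕ}

/-! ### Polynomials in one distinguished variable -/

/-! Up to radical, a saturation of `I = idealOf T` by `h` depends only on which minimal primes of
`I` contain `h`, and the radical determines the zeros over every `L`. So it suffices that each
minimal prime `P` contains the product of the initials iff it contains that of either U-set.

The core is `notMem_of_mem_supported`. Suppose each `f ∈ T` has a coefficient outside `P`.
Contracting `P` to the first `k` variables and extending back gives a chain of primes from `⊥` to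
`P`, strict at each leading variable. A nonzero element of `P` in the non-leading variables would
force a further strict step, against Krull's bound on the height by the number of generators. Now
`res p T` lies in the ideal of `p` and `T` and involves no leading variable, so it vanishes for all
`p ∈ P`.

The coefficients required exist on both sides: the initials themselves if their product avoids `P`;
otherwise an initial in the U-set, or a coefficient whose resultant is a nonzero constant. -/

theorem eval_asUni (k : Fin n) (p : MvPolynomial (Fin n) K) :
    (asUni k p).eval (X k) = p := by
  have h : ((Polynomial.aeval (X k : MvPolynomial (Fin n) K)).restrictScalars K).comp
      (aeval fun i => if i = k then (Polynomial.X : Polynomial (MvPolynomial (Fin n) K))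
        else Polynomial.C (X i)) = AlgHom.id K _ := by
    ext i
    by_cases hi : i = k <;> simp [hi]
  simpa [asUni, Polynomial.coe_aeval_eq_eval] using DFunLike.congr_fun h p

theorem coeff_asUni_mem_supported (k : Fin n) {s : Set (Fin n)} {p : MvPolynomial (Fin n) K}
    (hp : p ∈ supported K s) (i : ℕ) : (asUni k p).coeff i ∈ supported K (s \ {k}) := by
  suffices h : asUni k p ∈
      Polynomial.lifts (algebraMap (supported K (s \ {k})) (MvPolynomial (Fin n) K)) by
    obtain ⟨c, hc⟩ := (Polynomial.lifts_iff_coeff_lifts _).1 h i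
    rw [← hc]
    exact c.2
  rw [supported_eq_adjoin_X] at hp
  induction hp using Algebra.adjoin_induction with
  | mem x hx =>
    obtain ⟨j, hj, rfl⟩ := hx
    by_cases hjk : j = k
    · simpa [asUni, hjk] using Polynomial.X_mem_lifts _
    · have : (X j : MvPolynomial (Fin n) K) ∈ supported K (s \ {k}) :=
        X_mem_supported.2 ⟨hj, hjk⟩
      simpa [asUni, hjk] using Polynomial.C_mem_lifts
        (algebraMap (supported K (s \ {k})) (MvPolynomial (Fin n) K)) ⟨_, this⟩
  | algebraMap r =>
    have := Polynomial.C_mem_lifts (algebraMap (supported K (s \ {k})) (MvPolynomial (Fin n) K))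
      (algebraMap K _ r)
    simpa [asUni, algebraMap_eq] using this
  | add x y _ _ hx hy =>
    rw [asUni, map_add]
    exact add_mem hx hy
  | mul x y _ _ hx hy =>
    rw [asUni, map_mul]
    exact mul_mem hx hy

theorem natDegree_asUni_ne_zero {k : Fin n} {p : MvPolynomial (Fin n) K} (hk : k ∈ p.vars) :
    (asUni k p).natDegree ≠ 0 := by
  intro h
  have hp := eval_asUni k p
  rw [Polynomial.eq_C_of_natDegree_eq_zero h, Polynomial.eval_C] at hp
  have hm := coeff_asUni_mem_supported k (s := Set.univ) (p := p) (by simp) 0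
  rw [hp, mem_supported] at hm
  exact (hm hk).2 rfl

theorem resultant_mem_subalgebra {R A : Type*} [CommRing R] [CommRing A] [Algebra R A]
    (S : Subalgebra R A) {f g : Polynomial A} (hf : ∀ i, f.coeff i ∈ S) (hg : ∀ i, g.coeff i ∈ S)
    (a b : ℕ) : Polynomial.resultant f g a b ∈ S := by
  rw [Polynomial.resultant, Matrix.det_apply]
  refine sum_mem fun σ _ => ?_
  rw [Units.smul_def]
  refine zsmul_mem (prod_mem fun i _ => ?_) _
  generalize σ i = i'
  induction i using Fin.addCases <;> simp only [Polynomial.sylvester, Matrix.of_apply,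
    Fin.addCases_left, Fin.addCases_right] <;> split_ifs <;> first | exact zero_mem _ | apply_assumption

/-! ### Leading variables -/

theorem cls_eq_coe_iff {f : MvPolynomial (Fin n) K} {k : Fin n} :
    cls f = k ↔ ∃ h : f.vars.Nonempty, f.vars.max' h = k := by
  constructor
  · intro h
    have hne : f.vars.Nonempty := by
      rw [Finset.nonempty_iff_ne_empty]
      intro h0
      simp [cls, h0] at h
    refine ⟨hne, ?_⟩
    rw [cls, ← Finset.coe_max' hne] at h
    exact WithBot.coe_injective h
  · rintro ⟨h, rfl⟩
    exact (Finset.coe_max' h).symm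

theorem mem_vars_of_cls {f : MvPolynomial (Fin n) K} {k : Fin n} (h : cls f = k) : k ∈ f.vars := by
  obtain ⟨hne, rfl⟩ := cls_eq_coe_iff.1 h
  exact Finset.max'_mem _ _

theorem mem_supported_Iic_of_cls {f : MvPolynomial (Fin n) K} {k : Fin n} (h : cls f = k) :
    f ∈ supported K (Set.Iic k) := by
  obtain ⟨hne, rfl⟩ := cls_eq_coe_iff.1 h
  exact mem_supported.2 fun i hi => Finset.le_max' _ _ hi

theorem inLead_of_cls {f : MvPolynomial (Fin n) K} {k : Fin n} (h : cls f = k) :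
    inLead f = asUni k f := by
  obtain ⟨hne, rfl⟩ := cls_eq_coe_iff.1 h
  simp [inLead, hne]

theorem resLead_of_cls (p : MvPolynomial (Fin n) K) {f : MvPolynomial (Fin n) K} {k : Fin n}
    (h : cls f = k) : resLead p f = Polynomial.resultant (asUni k p) (asUni k f) := by
  obtain ⟨hne, rfl⟩ := cls_eq_coe_iff.1 h
  simp [resLead, hne]

theorem exists_cls_eq {f : MvPolynomial (Fin n) K}
    (hf : f ∉ Set.range (C : K → MvPolynomial (Fin n) K)) : ∃ k : Fin n, cls f = k := by
  have hne : f.vars.Nonempty := by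
    rw [Finset.nonempty_iff_ne_empty]
    intro h0
    have : f ∈ supported K (∅ : Set (Fin n)) := mem_supported.2 (by simp [h0])
    rw [supported_empty, Algebra.mem_bot] at this
    exact hf this
  exact ⟨_, cls_eq_coe_iff.2 ⟨hne, rfl⟩⟩

/-- Evaluate the Bézout identity for the resultant at `X k`. The identity needs one of the two
degrees to be nonzero, which `f` provides. -/
theorem resLead_mem_ideal {I : Ideal (MvPolynomial (Fin n) K)} {p f : MvPolynomial (Fin n) K}
    (hp : p ∈ I) (hf : f ∈ I) : resLead p f ∈ I := by
  by_cases hne : f.vars.Nonempty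
  · have hk : cls f = (f.vars.max' hne : Fin n) := (Finset.coe_max' hne).symm
    rw [resLead_of_cls p hk]
    generalize f.vars.max' hne = k at hk
    obtain ⟨a, b, -, -, e⟩ := Polynomial.exists_mul_add_mul_eq_C_resultant (asUni k p) (asUni k f)
      le_rfl le_rfl (Or.inr (natDegree_asUni_ne_zero (mem_vars_of_cls hk)))
    have e' := congrArg (Polynomial.eval (X k)) e
    rw [Polynomial.eval_add, Polynomial.eval_mul, Polynomial.eval_mul, eval_asUni, eval_asUni,
      Polynomial.eval_C] at e'
    rw [← e']
    exact add_mem (I.mul_mem_right _ hp) (I.mul_mem_right _ hf)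
  · simpa [resLead, hne] using hp

theorem res_mem_ideal {I : Ideal (MvPolynomial (Fin n) K)} {p : MvPolynomial (Fin n) K}
    {T : List (MvPolynomial (Fin n) K)} (hp : p ∈ I) (hT : ∀ f ∈ T, f ∈ I) : res p T ∈ I := by
  induction T with
  | nil => exact hp
  | cons f T ih =>
    exact resLead_mem_ideal (ih fun g hg => hT g (List.mem_cons_of_mem _ hg))
      (hT f List.mem_cons_self)

/-- The iterated resultant with respect to a triangular set is free of the leading variables. -/
theorem res_mem_supported (p : MvPolynomial (Fin n) K) {T : List (MvPolynomial (Fin n) K)}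
    (hc : ∀ f ∈ T, f ∉ Set.range (C : K → MvPolynomial (Fin n) K))
    (hi : T.Pairwise fun f g => cls f < cls g) :
    res p T ∈ supported K {k : Fin n | ∀ f ∈ T, cls f ≠ k} := by
  induction T with
  | nil => simp [res]
  | cons f T ih =>
    rw [List.pairwise_cons] at hi
    obtain ⟨k, hk⟩ := exists_cls_eq (hc f List.mem_cons_self)
    have ih' := ih (fun g hg => hc g (List.mem_cons_of_mem _ hg)) hi.2
    change resLead (res p T) f ∈ _
    rw [resLead_of_cls _ hk]
    -- Eliminating `x_k` introduces no later leading variable, since `f` only involves variables up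
    -- to `x_k` and later classes are larger.
    refine resultant_mem_subalgebra _ (fun i => ?_) (fun i => ?_) _ _
    · refine supported_mono ?_ (coeff_asUni_mem_supported k ih' i)
      rintro j ⟨hj, hjk⟩ g hg
      rcases List.mem_cons.1 hg with rfl | hg
      · rw [hk]
        exact fun h => hjk (WithBot.coe_injective h).symm
      · exact hj g hg
    · refine supported_mono ?_ (coeff_asUni_mem_supported k (mem_supported_Iic_of_cls hk) i)
      rintro j ⟨hj, hjk⟩ g hg
      rcases List.mem_cons.1 hg with rfl | hg
      · rw [hk]
        exact fun h => hjk (WithBot.coe_injective h).symm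
      · intro h
        have h1 := hi.1 g hg
        rw [hk, h, WithBot.coe_lt_coe] at h1
        exact absurd h1 (not_lt.2 hj)

/-! ### The chain of primes attached to a prime of `K[X]` -/

/-- Reduction modulo `P` of the first `k` variables only, the others being kept as variables. -/
def partialMk (P : Ideal (MvPolynomial (Fin n) K)) (k : ℕ) :
    MvPolynomial (Fin n) K →ₐ[K] MvPolynomial (Fin n) (MvPolynomial (Fin n) K ⧸ P) :=
  aeval fun i => if (i : ℕ) < k then C (Ideal.Quotient.mk P (X i)) else X i

/-- The extension to `K[X]` of the contraction of `P` to the first `k` variables. -/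
def partialIdeal (P : Ideal (MvPolynomial (Fin n) K)) (k : ℕ) : Ideal (MvPolynomial (Fin n) K) :=
  RingHom.ker (partialMk P k)

variable (P : Ideal (MvPolynomial (Fin n) K))

theorem mem_partialIdeal {k : ℕ} {p : MvPolynomial (Fin n) K} :
    p ∈ partialIdeal P k ↔ partialMk P k p = 0 := RingHom.mem_ker

instance isPrime_partialIdeal [P.IsPrime] (k : ℕ) : (partialIdeal P k).IsPrime :=
  RingHom.ker_isPrime _

theorem partialMk_eq_C {k : ℕ} {p : MvPolynomial (Fin n) K}
    (hp : ∀ i ∈ p.vars, (i : ℕ) < k) : partialMk P k p = C (Ideal.Quotient.mk P p) := by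
  refine hom_congr_vars (f₁ := (partialMk P k).toRingHom)
    (f₂ := C.comp (Ideal.Quotient.mk P)) ?_ (fun i hi _ => ?_) rfl
  · refine RingHom.ext fun a => ?_
    exact (partialMk P k).commutes a
  · simp [partialMk, hp i hi]

theorem partialMk_succ_eq {m : Fin n} {p : MvPolynomial (Fin n) K} (hp : m ∉ p.vars) :
    partialMk P (m + 1) p = partialMk P m p := by
  refine hom_congr_vars (f₁ := (partialMk P (m + 1)).toRingHom)
    (f₂ := (partialMk P m).toRingHom) (RingHom.ext fun a => ?_) (fun i hi _ => ?_) rfl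
  · exact ((partialMk P (m + 1)).commutes a).trans ((partialMk P m).commutes a).symm
  have : (i : ℕ) ≠ m := fun h => hp (Fin.ext h ▸ hi)
  have : (i : ℕ) < m + 1 ↔ (i : ℕ) < m := by omega
  simp only [partialMk, AlgHom.toRingHom_eq_coe, RingHom.coe_coe, aeval_X, this]

/-- Reducing `k + 1` variables factors through reducing `k` of them. -/
theorem partialIdeal_le_succ (k : ℕ) : partialIdeal P k ≤ partialIdeal P (k + 1) := by
  have h : ((aeval fun i : Fin n => if (i : ℕ) < k + 1 then C (Ideal.Quotient.mk P (X i)) else X i :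
      MvPolynomial (Fin n) (MvPolynomial (Fin n) K ⧸ P) →ₐ[_]
        MvPolynomial (Fin n) (MvPolynomial (Fin n) K ⧸ P)).restrictScalars K).comp
        (partialMk P k) = partialMk P (k + 1) := by
    ext1 i
    by_cases hi : (i : ℕ) < k
    · have hi' : (i : ℕ) < k + 1 := hi.trans (Nat.lt_succ_self k)
      simp only [partialMk, AlgHom.comp_apply, AlgHom.restrictScalars_apply, aeval_X, hi, hi',
        if_true, aeval_C, algebraMap_eq]
    · simp [partialMk, hi]
  intro p hp
  rw [mem_partialIdeal] at hp ⊢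
  rw [← h, AlgHom.comp_apply, hp, map_zero]

theorem partialIdeal_zero (hP : P ≠ ⊤) : partialIdeal P 0 = ⊥ := by
  have := Ideal.Quotient.nontrivial_iff.2 hP
  rw [eq_bot_iff]
  intro p hp
  rw [mem_partialIdeal] at hp
  have h : partialMk P 0 = mapAlgHom (Algebra.ofId K (MvPolynomial (Fin n) K ⧸ P)) := by
    ext1 i
    simp [partialMk]
  rw [h, mapAlgHom_apply] at hp
  exact map_injective _ (algebraMap K (MvPolynomial (Fin n) K ⧸ P)).injective
    (hp.trans (map_zero _).symm)

theorem partialIdeal_card : partialIdeal P n = P := by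
  ext p
  rw [mem_partialIdeal, partialMk_eq_C P (fun i _ => i.2), C_eq_zero,
    Ideal.Quotient.eq_zero_iff_mem]

open Classical in
/-- The height of a prime is at least the number of strict steps of its chain. -/
theorem card_filter_le_height_partialIdeal [P.IsPrime] {k : ℕ} (hk : k ≤ n) :
    ((Finset.univ.filter fun m : Fin n =>
      (m : ℕ) < k ∧ partialIdeal P m < partialIdeal P (m + 1)).card : ℕ∞) ≤
      (partialIdeal P k).height := by
  induction k with
  | zero => simp
  | succ k ih =>
    have ih' := ih (by omega)
    by_cases hlt : partialIdeal P k < partialIdeal P (k + 1)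
    · refine le_trans ?_ (Ideal.height_add_one_le_of_lt_of_isPrime hlt)
      refine le_trans ?_ (add_le_add_left ih' 1)
      norm_cast
      refine le_trans (Finset.card_le_card ?_) (Finset.card_insert_le (⟨k, hk⟩ : Fin n) _)
      intro m
      simp only [Finset.mem_filter, Finset.mem_univ, true_and, Finset.mem_insert, Fin.ext_iff]
      rintro ⟨h1, h2⟩
      by_cases h : (m : ℕ) = k
      · exact Or.inl h
      · exact Or.inr ⟨by omega, h2⟩
    · refine le_trans ?_ (ih'.trans (Ideal.height_mono (partialIdeal_le_succ P k)))
      norm_cast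
      refine Finset.card_le_card ?_
      intro m
      simp only [Finset.mem_filter, Finset.mem_univ, true_and]
      rintro ⟨h1, h2⟩
      refine ⟨?_, h2⟩
      by_contra h
      have : (m : ℕ) = k := by omega
      rw [this] at h2
      exact hlt h2

/-- If some coefficient of `f` is not in `P`, the chain is strict at the leading variable of
`f ∈ P`. -/
theorem partialIdeal_lt_of_cls {f c : MvPolynomial (Fin n) K} {k : Fin n}
    (hk : cls f = k) (hf : f ∈ P) (hc : c ∈ coeffSet f) (hcP : c ∉ P) :
    partialIdeal P k < partialIdeal P (k + 1) := by
  refine lt_of_le_of_ne (partialIdeal_le_succ P k) fun h => ?_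
  have hmem : f ∈ partialIdeal P (k + 1) := by
    rw [mem_partialIdeal, partialMk_eq_C, Ideal.Quotient.eq_zero_iff_mem.2 hf, C_0]
    intro i hi
    have : i ≤ k := mem_supported.1 (mem_supported_Iic_of_cls hk) hi
    exact Nat.lt_succ_of_le this
  rw [← h, mem_partialIdeal] at hmem
  rw [coeffSet, inLead_of_cls hk, Polynomial.mem_coeffs_iff] at hc
  obtain ⟨i, -, rfl⟩ := hc
  have hcoeff (j : ℕ) : partialMk P k ((asUni k f).coeff j) =
      C (Ideal.Quotient.mk P ((asUni k f).coeff j)) := by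
    refine partialMk_eq_C P fun l hl => ?_
    have := mem_supported.1 (coeff_asUni_mem_supported k (mem_supported_Iic_of_cls hk) j) hl
    exact lt_of_le_of_ne (Set.mem_Iic.1 this.1) fun h => this.2 (Fin.ext h)
  -- After reduction, `x_k` is the only variable left in `f`, so sending every variable to one
  -- indeterminate loses nothing and recovers `f` as a univariate polynomial modulo `P`.
  have hmap : (aeval (fun _ : Fin n => (Polynomial.X : Polynomial (MvPolynomial (Fin n) K ⧸ P))))
      (partialMk P k f) = (asUni k f).map (Ideal.Quotient.mk P) := by
    conv_lhs => rw [← eval_asUni k f]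
    rw [Polynomial.eval_eq_sum, Polynomial.sum, map_sum, map_sum]
    conv_rhs => rw [← Polynomial.sum_C_mul_X_pow_eq (asUni k f), Polynomial.sum,
      Polynomial.map_sum]
    refine Finset.sum_congr rfl fun j _ => ?_
    rw [map_mul, map_pow, hcoeff]
    simp [partialMk]
  rw [hmem, map_zero] at hmap
  have := congrArg (fun q => Polynomial.coeff q i) hmap
  simp only [Polynomial.coeff_zero, Polynomial.coeff_map] at this
  exact hcP (Ideal.Quotient.eq_zero_iff_mem.1 this.symm)

/-- A nonzero element of `P` involves the variable at some strict step of the chain. -/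
theorem exists_mem_vars_partialIdeal_lt (hP : P ≠ ⊤) {r : MvPolynomial (Fin n) K} (hr : r ≠ 0)
    (hrP : r ∈ P) : ∃ m ∈ r.vars, partialIdeal P m < partialIdeal P (m + 1) := by
  by_contra! hcon
  -- Climb the chain from `⊥` to `P`: a step either is not strict or concerns a variable absent from
  -- `r`, so `r` never enters.
  suffices h : ∀ k ≤ n, r ∉ partialIdeal P k by
    exact h n le_rfl (by rwa [partialIdeal_card])
  intro k
  induction k with
  | zero => simpa [partialIdeal_zero P hP] using hr
  | succ k ih =>
    intro hk hmem
    have hk' := ih (by omega)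
    by_cases hv : (⟨k, hk⟩ : Fin n) ∈ r.vars
    · exact hcon _ hv (lt_of_le_of_ne (partialIdeal_le_succ P k) fun h => hk' (h ▸ hmem))
    · rw [mem_partialIdeal] at hmem hk'
      exact hk' ((partialMk_succ_eq P hv).symm.trans hmem)

/-! ### Minimal primes of a triangular set -/

variable {P} {T : List (MvPolynomial (Fin n) K)}

/-- If no member of `T` vanishes identically in its leading variable modulo a minimal prime `P` of
`T`, then the variables that are not leading are algebraically independent modulo `P`. -/
theorem notMem_of_mem_supported (hT : IsTriangularSet T) (hP : P ∈ (idealOf T).minimalPrimes)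
    (hc : ∀ f ∈ T, ∃ c ∈ coeffSet f, c ∉ P) {r : MvPolynomial (Fin n) K} (hr : r ≠ 0)
    (hrs : r ∈ supported K {k : Fin n | ∀ f ∈ T, cls f ≠ k}) : r ∉ P := by
  classical
  intro hrP
  have hprime : P.IsPrime := hP.1.1
  have hle : ∀ f ∈ T, f ∈ P := fun f hf => hP.1.2 (Ideal.subset_span hf)
  obtain ⟨m, hm, hlt⟩ := exists_mem_vars_partialIdeal_lt P hprime.ne_top hr hrP
  have hfree := mem_supported.1 hrs hm
  have : Nonempty (Fin n) := ⟨m⟩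
  choose! lead hlead using fun f hf => exists_cls_eq (hT.nonconst f hf)
  have hheight := card_filter_le_height_partialIdeal P (le_refl n)
  rw [partialIdeal_card] at hheight
  have hspan : idealOf T = Ideal.span (T.toFinset : Set (MvPolynomial (Fin n) K)) := by
    simp [idealOf]
  rw [hspan] at hP
  -- Krull's height theorem: there are at most as many strict steps as members of `T`.
  have hcard := hheight.trans (Ideal.height_le_card_of_mem_minimalPrimes_span_finset hP)
  norm_cast at hcard
  have hinj : Set.InjOn lead (T.toFinset : Set (MvPolynomial (Fin n) K)) := by
    intro f hf g hg hfg
    rw [Finset.mem_coe, List.mem_toFinset] at hf hg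
    by_contra hne
    have hsymm : T.Pairwise fun f g => cls f ≠ cls g := hT.increasing.imp fun h => h.ne
    have : Std.Symm fun f g : MvPolynomial (Fin n) K => cls f ≠ cls g := ⟨fun _ _ h => h.symm⟩
    exact hsymm.forall hf hg hne (by rw [hlead f hf, hlead g hg, hfg])
  have hnot : m ∉ T.toFinset.image lead := by
    rw [Finset.mem_image]
    rintro ⟨f, hf, rfl⟩
    rw [List.mem_toFinset] at hf
    exact hfree f hf (hlead f hf)
  have hsub : insert m (T.toFinset.image lead) ⊆ Finset.univ.filter fun m : Fin n =>
      (m : ℕ) < n ∧ partialIdeal P m < partialIdeal P (m + 1) := by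
    intro j hj
    rw [Finset.mem_filter]
    refine ⟨Finset.mem_univ _, j.2, ?_⟩
    rcases Finset.mem_insert.1 hj with rfl | hj
    · exact hlt
    · obtain ⟨f, hf, rfl⟩ := Finset.mem_image.1 hj
      rw [List.mem_toFinset] at hf
      obtain ⟨c, hcf, hcP⟩ := hc f hf
      exact partialIdeal_lt_of_cls P (hlead f hf) (hle f hf) hcf hcP
  have := Finset.card_le_card hsub
  rw [Finset.card_insert_of_notMem hnot, Finset.card_image_of_injOn hinj] at this
  omega

theorem res_eq_zero_of_mem (hT : IsTriangularSet T) (hP : P ∈ (idealOf T).minimalPrimes)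
    (hc : ∀ f ∈ T, ∃ c ∈ coeffSet f, c ∉ P) {p : MvPolynomial (Fin n) K} (hp : p ∈ P) :
    res p T = 0 := by
  by_contra h
  exact notMem_of_mem_supported hT hP hc h (res_mem_supported p hT.nonconst hT.increasing)
    (res_mem_ideal hp fun f hf => hP.1.2 (Ideal.subset_span hf))

theorem ini_mem_coeffSet {f : MvPolynomial (Fin n) K}
    (hf : f ∉ Set.range (C : K → MvPolynomial (Fin n) K)) : ini f ∈ coeffSet f := by
  obtain ⟨k, hk⟩ := exists_cls_eq hf
  have h0 : inLead f ≠ 0 := by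
    rw [inLead_of_cls hk]
    intro h
    have := natDegree_asUni_ne_zero (mem_vars_of_cls hk)
    simp [h] at this
  exact Polynomial.mem_coeffs_iff.2 ⟨_, Polynomial.natDegree_mem_support_of_nonzero h0, rfl⟩

theorem uSet_subset_uSetFull (hT : IsTriangularSet T) : uSet T ⊆ uSetFull T := by
  classical
  refine Finset.union_subset_union_left fun c hc => ?_
  obtain ⟨f, hf, rfl⟩ := Finset.mem_image.1 hc
  refine Finset.mem_biUnion.2 ⟨f, hf, Finset.mem_filter.2 ⟨?_, ?_⟩⟩
  · exact ini_mem_coeffSet (hT.nonconst f (by simpa using (Finset.mem_filter.1 hf).1))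
  · exact (Finset.mem_filter.1 hf).2.1

theorem prod_ini_mem_iff [P.IsPrime] : (T.map ini).prod ∈ P ↔ ∃ f ∈ T, ini f ∈ P := by
  induction T with
  | nil => simpa using (Ideal.ne_top_iff_one P).1 ‹P.IsPrime›.ne_top
  | cons f T ih => simp [Ideal.IsPrime.mul_mem_iff_mem_or_mem, ih]

/-- If no initial lies in `P`, the initials serve as coefficients outside `P`. A member of the full
U-set in `P` then has zero resultant, so it must be a singular initial, which is excluded. -/
theorem prod_ini_mem_of_prod_uSetFull_mem (hT : IsTriangularSet T)
    (hP : P ∈ (idealOf T).minimalPrimes) (h : ∏ u ∈ uSetFull T, u ∈ P) :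
    (T.map ini).prod ∈ P := by
  classical
  have hprime : P.IsPrime := hP.1.1
  by_contra hJ
  rw [prod_ini_mem_iff] at hJ
  push Not at hJ
  obtain ⟨u, hu, huP⟩ := (Ideal.IsPrime.prod_mem_iff).1 h
  rcases Finset.mem_union.1 hu with hu | hu
  · obtain ⟨f, hf, hu⟩ := Finset.mem_biUnion.1 hu
    exact (Finset.mem_filter.1 hu).2 (res_eq_zero_of_mem hT hP
      (fun f hf => ⟨ini f, ini_mem_coeffSet (hT.nonconst f hf), hJ f hf⟩) huP)
  · obtain ⟨f, hf, rfl⟩ := Finset.mem_image.1 (Finset.mem_filter.1 hu).1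
    exact hJ f (by simpa using hf) huP

theorem prod_uSet_mem_of_prod_ini_mem (hT : IsTriangularSet T)
    (hP : P ∈ (idealOf T).minimalPrimes) (h : (T.map ini).prod ∈ P) :
    ∏ u ∈ uSet T, u ∈ P := by
  classical
  have hprime : P.IsPrime := hP.1.1
  by_contra hU
  rw [Ideal.IsPrime.prod_mem_iff] at hU
  push Not at hU
  have hsing : ∀ f ∈ T, res (ini f) T = 0 → ini f ∉ P := fun f hf h0 =>
    hU _ (Finset.mem_union_right _ (Finset.mem_filter.2
      ⟨Finset.mem_image_of_mem _ (List.mem_toFinset.2 hf), h0⟩))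
  have hc : ∀ f ∈ T, ∃ c ∈ coeffSet f, c ∉ P := by
    intro f hf
    by_cases h0 : res (ini f) T = 0
    · exact ⟨_, ini_mem_coeffSet (hT.nonconst f hf), hsing f hf h0⟩
    by_cases hR : resSet T f ∩ Set.range (C : K → MvPolynomial (Fin n) K) = ∅
    · exact ⟨_, ini_mem_coeffSet (hT.nonconst f hf), hU _ (Finset.mem_union_left _
        (Finset.mem_image_of_mem _ (Finset.mem_filter.2 ⟨List.mem_toFinset.2 hf, h0, hR⟩)))⟩
    · obtain ⟨_, ⟨hr, c, hcf, rfl⟩, a, ha⟩ := Set.nonempty_iff_ne_empty.2 hR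
      -- If `c` were in `P`, so would be its resultant, a nonzero constant.
      refine ⟨c, hcf, fun hcP => ?_⟩
      have hmem := res_mem_ideal hcP fun f hf => hP.1.2 (Ideal.subset_span (s := {f | f ∈ T}) hf)
      rw [← ha] at hmem hr
      have ha0 : a ≠ 0 := by
        rintro rfl
        exact hr C_0
      exact hprime.ne_top (Ideal.eq_top_of_isUnit_mem _ hmem ((Ne.isUnit ha0).map C))
  obtain ⟨f, hf, hfP⟩ := prod_ini_mem_iff.1 h
  exact hsing f hf (res_eq_zero_of_mem hT hP hc hfP) hfP

theorem prod_uSetFull_mem_of_prod_uSet_mem (hT : IsTriangularSet T) (h : ∏ u ∈ uSet T, u ∈ P) :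
    ∏ u ∈ uSetFull T, u ∈ P :=
  Ideal.mem_of_dvd _ (Finset.prod_dvd_prod_of_subset _ _ _ (uSet_subset_uSetFull hT)) h

/-! ### Saturations -/

/-- If `h ^ q * g ∈ I`, each minimal prime contains `g` or `h`, hence `h' * g`; so `h' * g` lies in
the radical of `I`. -/
theorem saturate_le_radical {I : Ideal (MvPolynomial (Fin n) K)} {h h' : MvPolynomial (Fin n) K}
    (hI : ∀ P ∈ I.minimalPrimes, h ∈ P → h' ∈ P) : saturate I h ≤ (saturate I h').radical := by
  rintro g ⟨q, -, hg⟩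
  have hmem : h' * g ∈ I.radical := by
    rw [← Ideal.sInf_minimalPrimes, Ideal.mem_sInf]
    intro P hP
    have hprime : P.IsPrime := hP.1.1
    rcases hprime.mem_or_mem (hP.1.2 hg) with h1 | h1
    · exact P.mul_mem_right _ (hI P hP (hprime.mem_of_pow_mem _ h1))
    · exact P.mul_mem_left _ h1
  obtain ⟨m, hm⟩ := hmem
  -- The exponent `m + 1` instead of `m` keeps it positive, as the saturation demands.
  refine ⟨m + 1, m + 1, m.succ_pos, ?_⟩
  rw [← mul_pow, pow_succ]
  exact I.mul_mem_right _ hm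

theorem zeroLocus_subset_of_le_radical (L : Type*) [Field L] [Algebra K L]
    {I J : Ideal (MvPolynomial (Fin n) K)} (h : I ≤ J.radical) :
    zeroLocus L J ⊆ zeroLocus L I := by
  intro x hx p hp
  obtain ⟨m, hm⟩ := h hp
  have := hx _ hm
  rw [map_pow] at this
  exact eq_zero_of_pow_eq_zero this

theorem zeroLocus_saturate_congr (L : Type*) [Field L] [Algebra K L]
    {I : Ideal (MvPolynomial (Fin n) K)} {h h' : MvPolynomial (Fin n) K}
    (hI : ∀ P ∈ I.minimalPrimes, h ∈ P ↔ h' ∈ P) :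
    zeroLocus L (saturate I h) = zeroLocus L (saturate I h') :=
  Set.Subset.antisymm
    (zeroLocus_subset_of_le_radical L (saturate_le_radical fun P hP => (hI P hP).2))
    (zeroLocus_subset_of_le_radical L (saturate_le_radical fun P hP => (hI P hP).1))

end TriSet

end

theorem theorem4p1 {K : Type*} [Field K] [CharZero K] {n : ℕ}
    (T : List (MvPolynomial (Fin n) K)) (hT : TriSet.IsTriangularSet T)
    (L : Type*) [Field L] [Algebra K L] :
    MvPolynomial.zeroLocus L (TriSet.sat T) =
        MvPolynomial.zeroLocus L
          (TriSet.saturate (TriSet.idealOf T) (∏ u ∈ TriSet.uSet T, u)) ∧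
      MvPolynomial.zeroLocus L (TriSet.sat T) =
        MvPolynomial.zeroLocus L
          (TriSet.saturate (TriSet.idealOf T) (∏ u ∈ TriSet.uSetFull T, u)) := by
  refine ⟨TriSet.zeroLocus_saturate_congr L fun P hP => ⟨?_, fun h => ?_⟩,
    TriSet.zeroLocus_saturate_congr L fun P hP => ⟨fun h => ?_, ?_⟩⟩
  · exact TriSet.prod_uSet_mem_of_prod_ini_mem hT hP
  · exact TriSet.prod_ini_mem_of_prod_uSetFull_mem hT hP
      (TriSet.prod_uSetFull_mem_of_prod_uSet_mem hT h)
  · exact TriSet.prod_uSetFull_mem_of_prod_uSet_mem hT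
      (TriSet.prod_uSet_mem_of_prod_ini_mem hT hP h)
  · exact TriSet.prod_ini_mem_of_prod_uSetFull_mem hT hP
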